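/- Work in the Grothendieck topos of sheaves of sets on a site $(C,J)$, and read all statements in its internal (Kripke–Joyal) logic: a "point" of a sheaf is a section at an arbitrary stage $c\in C$, "for all" ranges over all stages, and "there exists" means existence on a $J$-covering sieve. *Scalars.* Let $R$ be a sheaf of commutative $\mathbb Q$-algebras satisfying the Kock–Lawvere axiom: for every ideal $I\subseteq \mathbb Q[X_1,\dots,X_n]$ with $\mathfrak m^k\subseteq I\subseteq\mathfrak m=(X_1,\dots,X_n)$ for some $k$, every map $\{d\in R^n: p(d)=0\ \forall p\in I\}\to R$ is given by a polynomial with coefficients in $R$, unique modulo $I$. On $R^n$ put $p\sim q$ iff $(q_i-p_i)(q_j-p_j)=0$ for all $i,j$. *Manifolds.* Let $M$ be a sheaf with a reflexive symmetric relation $\sim$ (a subsheaf of $M\times M$). A subobject is *formally open* if it is closed under $\sim$. $M$ is a (formal) *manifold* if each point of $M$ locally lies in a formally open $U\subseteq M$ that has, for some $n$, an embedding $U\to R^n$ preserving and reflecting $\sim$ and with formally open image. An *$n$-path* from $a$ to $b$ is a sequence $a=x_0\sim x_1\sim\dots\sim x_n=b$; $M$ is *path connected* if any two points are joined by an $n$-path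 for some $n$ (internally: locally). *Connections.* An *affine connection* on $M$ is a partial ternary operation $[zxy]\in M$, defined for $x\sim y$ and $x\sim z$, with $[zxy]\sim y$, $[zxy]\sim z$, $[zxx]=z$, $[xxy]=y$ and $[[zxy]yx]=z$. It is *symmetric* if $[zxy]=[yxz]$, and *flat* if $[[axy]yz]=[axz]$ whenever $x,y,z$ are mutual neighbours and $a\sim x$. Two paths $(x,y_1,\dots,y_n)$, $(x,z_1,\dots,z_m)$ span the *grid* $u_{0,0}=x$, $u_{0,j}=y_j$, $u_{i,0}=z_i$, $u_{i+1,j+1}=[u_{i+1,j}\,u_{i,j}\,u_{i,j+1}]$, with codomain $u_{m,n}$. **Theorem.** Let $M$ be a path connected manifold with a symmetric flat affine connection. Then there is a unique everywhere defined operation $M\times M\times M\to M$, $(z,x,y)\mapsto[zxy]$, such that $[zxy]$ is the codomain of the grid spanned by any path from $x$ to $y$ and any path from $x$ to $z$; it extends the given connection. For each $o\in M$ the operation $x+_o y:=[xoy]$ makes $M$ an abelian group with unit $o$. For any other $o'\in M$, the map $z\mapsto[zoo']$ is a bijection and a group isomorphism from $(M,+_o)$ to $(M,+_{o'})$. -/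

import Mathlib

open CategoryTheory Opposite

universe w r v u

namespace Synthetic

/-! ## Scalars: a ring object satisfying the Kock-Lawvere axiom

Everything takes place in the Grothendieck topos of sheaves of sets on a site `(C, J)`.  Assertions
in the internal language of that topos are spelled out by Kripke-Joyal forcing: points of an object
`F` are sections `s` in `F(c)` at a stage `c`; "for all" ranges over all stages, "there exists" means
existence on a covering sieve. -/

section Line

variable {C : Type u} [Category.{v} C]

/-- Restriction of a scalar along a change of stage `f : d ⟶ c`. -/
def scalarRes (R : Cᵒᵖ ⥤ CommAlgCat.{r} ℚ) {c d : C} (f : d ⟶ c) :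
    R.obj (op c) →ₐ[ℚ] R.obj (op d) :=
  (R.map f.op).hom

/-- An ideal `I` of `ℚ[X₁,…,Xₙ]` presents a Weil algebra `ℚ[X₁,…,Xₙ]/I` if it is contained in the
ideal `𝔪 = (X₁,…,Xₙ)` and contains a power of it. -/
def IsWeilIdeal {n : ℕ} (I : Ideal (MvPolynomial (Fin n) ℚ)) : Prop :=
  I ≤ Ideal.span (Set.range MvPolynomial.X) ∧
    ∃ k : ℕ, Ideal.span (Set.range MvPolynomial.X) ^ k ≤ I

/-- The infinitesimal object `Spec_R (ℚ[X]/I)` at stage `c`: the `d ∈ R(c)ⁿ` at which all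
polynomials of `I` vanish. -/
def weilSpec (R : Cᵒᵖ ⥤ CommAlgCat.{r} ℚ) {n : ℕ} (I : Ideal (MvPolynomial (Fin n) ℚ)) (c : C) :
    Set (Fin n → R.obj (op c)) :=
  {d | ∀ p ∈ I, MvPolynomial.aeval d p = 0}

/-- The value at `d ∈ R(c')ⁿ` of a polynomial with coefficients in `R(c)`, for `g : c' ⟶ c`. -/
noncomputable def evalAt (R : Cᵒᵖ ⥤ CommAlgCat.{r} ℚ) {n : ℕ} {c c' : C} (g : c' ⟶ c)
    (P : MvPolynomial (Fin n) (R.obj (op c))) (d : Fin n → R.obj (op c')) : R.obj (op c') :=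
  MvPolynomial.eval₂ (scalarRes R g).toRingHom d P

/-- A map `Spec_R (ℚ[X]/I) → R` in the topos, defined over the stage `c`: a family of functions,
compatible with restriction, at all stages over `c`. -/
structure WeilMap (R : Cᵒᵖ ⥤ CommAlgCat.{r} ℚ) {n : ℕ} (I : Ideal (MvPolynomial (Fin n) ℚ))
    (c : C) where
  toFun : ∀ {c' : C}, (c' ⟶ c) → (Fin n → R.obj (op c')) → R.obj (op c')
  natural : ∀ {c' c'' : C} (g : c' ⟶ c) (h : c'' ⟶ c') (d : Fin n → R.obj (op c')),
    d ∈ weilSpec R I c' →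
      toFun (h ≫ g) (fun i => scalarRes R h (d i)) = scalarRes R h (toFun g d)

/-- A line object: a sheaf of commutative `ℚ`-algebras satisfying the general Kock-Lawvere axiom,
i.e. for each Weil algebra `W = ℚ[X]/I` the canonical map `R ⊗ W → R ^ (Spec_R W)` is an
isomorphism: each map `Spec_R W → R` is given by a polynomial, which is unique modulo `I`. -/
structure LineObject (J : GrothendieckTopology C) where
  ring : Cᵒᵖ ⥤ CommAlgCat.{r} ℚ
  isSheaf : Presheaf.IsSheaf J (ring ⋙ forget (CommAlgCat.{r} ℚ))
  kl_exists : ∀ {n : ℕ} (I : Ideal (MvPolynomial (Fin n) ℚ)), IsWeilIdeal I →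
    ∀ (c : C) (f : WeilMap ring I c), ∃ P : MvPolynomial (Fin n) (ring.obj (op c)),
      ∀ {c' : C} (g : c' ⟶ c), ∀ d ∈ weilSpec ring I c', f.toFun g d = evalAt ring g P d
  kl_unique : ∀ {n : ℕ} (I : Ideal (MvPolynomial (Fin n) ℚ)), IsWeilIdeal I →
    ∀ (c : C) (P : MvPolynomial (Fin n) (ring.obj (op c))),
      (∀ {c' : C} (g : c' ⟶ c), ∀ d ∈ weilSpec ring I c', evalAt ring g P d = 0) →
        P ∈ I.map (MvPolynomial.map (algebraMap ℚ (ring.obj (op c))))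

/-- The first order neighbour relation on `Rⁿ`: `p ∼ q` iff `q - p` lies in
`D(n) = {d ∣ dᵢ dⱼ = 0 for all i, j}`. -/
def CoordNear (R : Cᵒᵖ ⥤ CommAlgCat.{r} ℚ) {n : ℕ} {c : C} (p q : Fin n → R.obj (op c)) : Prop :=
  ∀ i j, (q i - p i) * (q j - p j) = 0

end Line

/-! ## Spaces with a neighbour relation and formal manifolds -/

section Spaces

variable {C : Type u} [Category.{v} C]

/-- A sheaf `M` (an object of the topos) with a reflexive symmetric relation `∼`,
i.e. a reflexive symmetric subobject `M₍₁₎` of `M × M`. -/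
structure NeighbourSpace (J : GrothendieckTopology C) where
  sheaf : Sheaf J (Type w)
  near : ∀ {c : C}, sheaf.obj.obj (op c) → sheaf.obj.obj (op c) → Prop
  near_refl : ∀ {c : C} (x : sheaf.obj.obj (op c)), near x x
  near_symm : ∀ {c : C} {x y : sheaf.obj.obj (op c)}, near x y → near y x
  near_res : ∀ {c d : C} (f : d ⟶ c) {x y : sheaf.obj.obj (op c)}, near x y →
    near (sheaf.obj.map f.op x) (sheaf.obj.map f.op y)
  near_local : ∀ {c : C} (S : Sieve c), S ∈ J c → ∀ x y : sheaf.obj.obj (op c),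
    (∀ {d : C} (f : d ⟶ c), S f → near (sheaf.obj.map f.op x) (sheaf.obj.map f.op y)) → near x y

variable {J : GrothendieckTopology C}

/-- The sections of `M` at stage `c`. -/
abbrev NeighbourSpace.Pt (M : NeighbourSpace.{w} J) (c : C) : Type w := M.sheaf.obj.obj (op c)

/-- Restriction of sections along a change of stage. -/
def NeighbourSpace.res (M : NeighbourSpace.{w} J) {c d : C} (f : d ⟶ c) (x : M.Pt c) : M.Pt d :=
  M.sheaf.obj.map f.op x

/-- A coordinate chart of `M` over the stage `c`: a subobject `U` of `M` (`domain`, a subsheaf over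
`c`) that is formally open (closed under `∼`), with an embedding `U → Rⁿ` (`coord`) that preserves
and reflects `∼` and whose image is formally open in `Rⁿ`. -/
structure Chart (R : LineObject.{r} J) (M : NeighbourSpace.{w} J) (c : C) where
  dim : ℕ
  domain : ∀ {d : C}, (d ⟶ c) → Set (M.Pt d)
  domain_res : ∀ {d e : C} (g : d ⟶ c) (h : e ⟶ d) {x : M.Pt d},
    x ∈ domain g → M.res h x ∈ domain (h ≫ g)
  domain_local : ∀ {d : C} (g : d ⟶ c) (S : Sieve d), S ∈ J d → ∀ x : M.Pt d,
    (∀ {e : C} (h : e ⟶ d), S h → M.res h x ∈ domain (h ≫ g)) → x ∈ domain g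
  domain_open : ∀ {d : C} (g : d ⟶ c) {x y : M.Pt d}, x ∈ domain g → M.near x y → y ∈ domain g
  coord : ∀ {d : C} (g : d ⟶ c), domain g → Fin dim → R.ring.obj (op d)
  coord_res : ∀ {d e : C} (g : d ⟶ c) (h : e ⟶ d) (x : domain g) (i : Fin dim),
    coord (h ≫ g) ⟨M.res h x.1, domain_res g h x.2⟩ i = scalarRes R.ring h (coord g x i)
  coord_injective : ∀ {d : C} (g : d ⟶ c), Function.Injective (coord g)
  coord_near : ∀ {d : C} (g : d ⟶ c) (x y : domain g),
    M.near x.1 y.1 ↔ CoordNear R.ring (coord g x) (coord g y)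
  coord_open : ∀ {d : C} (g : d ⟶ c) (x : domain g) (q : Fin dim → R.ring.obj (op d)),
    CoordNear R.ring (coord g x) q → ∃ y : domain g, coord g y = q

/-- `M` is a (formal) manifold: each point of `M` lies, locally, in the domain of a chart. -/
def IsManifold (R : LineObject.{r} J) (M : NeighbourSpace.{w} J) : Prop :=
  ∀ (c : C) (x : M.Pt c), ∃ S : Sieve c, S ∈ J c ∧ ∀ {d : C} (g : d ⟶ c), S g →
    ∃ φ : Chart R M d, M.res g x ∈ φ.domain (𝟙 d)

/-- `p 0, …, p n` is an `n`-path from `a` to `b` at stage `c`; later entries of `p` are ignored. -/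
def NeighbourSpace.IsPath (M : NeighbourSpace.{w} J) {c : C} (n : ℕ) (p : ℕ → M.Pt c)
    (a b : M.Pt c) : Prop :=
  p 0 = a ∧ p n = b ∧ ∀ i < n, M.near (p i) (p (i + 1))

/-- `M` is path connected: any two points are, locally, joined by an `n`-path for some `n`. -/
def NeighbourSpace.PathConnected (M : NeighbourSpace.{w} J) : Prop :=
  ∀ (c : C) (x y : M.Pt c), ∃ S : Sieve c, S ∈ J c ∧ ∀ {d : C} (g : d ⟶ c), S g →
    ∃ (n : ℕ) (p : ℕ → M.Pt d), M.IsPath n p (M.res g x) (M.res g y)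

/-! ## Affine connections and their extension -/

/-- An affine connection on `M`: a partial ternary operation `op z x y = [zxy]`, defined for `x ∼ y`
and `x ∼ z` (values of `op` elsewhere are irrelevant), which is a morphism in the topos and
satisfies the book-keeping, unit and inversion laws. -/
structure AffineConnection (M : NeighbourSpace.{w} J) where
  op : ∀ {c : C}, M.Pt c → M.Pt c → M.Pt c → M.Pt c
  op_res : ∀ {c d : C} (f : d ⟶ c) (z x y : M.Pt c), M.near x y → M.near x z →
    M.res f (op z x y) = op (M.res f z) (M.res f x) (M.res f y)
  near_right : ∀ {c : C} (z x y : M.Pt c), M.near x y → M.near x z → M.near (op z x y) y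
  near_left : ∀ {c : C} (z x y : M.Pt c), M.near x y → M.near x z → M.near (op z x y) z
  unit_left : ∀ {c : C} (z x : M.Pt c), M.near x z → op z x x = z
  unit_right : ∀ {c : C} (x y : M.Pt c), M.near x y → op x x y = y
  inversion : ∀ {c : C} (z x y : M.Pt c), M.near x y → M.near x z → op (op z x y) y x = z

/-- Symmetric (torsion free): `[zxy] = [yxz]`. -/
def AffineConnection.IsSymmetric {M : NeighbourSpace.{w} J} (L : AffineConnection M) : Prop :=
  ∀ {c : C} (z x y : M.Pt c), M.near x y → M.near x z → L.op z x y = L.op y x z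

/-- Flat (curvature free): for mutual neighbours `x`, `y`, `z`, transport from `x` to `y` followed
by transport from `y` to `z` is transport from `x` to `z`, on all neighbours `a` of `x`. -/
def AffineConnection.IsFlat {M : NeighbourSpace.{w} J} (L : AffineConnection M) : Prop :=
  ∀ {c : C} (x y z a : M.Pt c), M.near x y → M.near y z → M.near x z → M.near x a →
    L.op (L.op a x y) y z = L.op a x z

/-- The row of a grid above a given `row`, starting with `a`. -/
def gridStep {α : Type w} (op : α → α → α → α) (row : ℕ → α) (a : α) : ℕ → α
  | 0 => a
  | j + 1 => op (gridStep op row a j) (row j) (row (j + 1))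

/-- The grid `u` spanned by two paths `y`, `z` with common domain: `u 0 j = y j`, `u i 0 = z i` and
`u (i+1) (j+1) = [u (i+1) j, u i j, u i (j+1)]`. -/
def grid {α : Type w} (op : α → α → α → α) (y z : ℕ → α) : ℕ → ℕ → α
  | 0 => y
  | i + 1 => gridStep op (grid op y z i) (z (i + 1))

/-- An everywhere defined ternary operation on `M`, i.e. a morphism `M × M × M → M`. -/
structure TernaryOp (M : NeighbourSpace.{w} J) where
  op : ∀ {c : C}, M.Pt c → M.Pt c → M.Pt c → M.Pt c
  op_res : ∀ {c d : C} (f : d ⟶ c) (z x y : M.Pt c),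
    M.res f (op z x y) = op (M.res f z) (M.res f x) (M.res f y)

/-- `B` is the big operation of `L`: `[zxy]` is the codomain of the grid spanned by any path from
`x` to `y` and any path from `x` to `z`. -/
def TernaryOp.IsExtensionOf {M : NeighbourSpace.{w} J} (B : TernaryOp M)
    (L : AffineConnection M) : Prop :=
  ∀ {c : C} (x y z : M.Pt c) (n m : ℕ) (p q : ℕ → M.Pt c),
    M.IsPath n p x y → M.IsPath m q x z → B.op z x y = grid L.op p q m n

end Spaces

/-- `add` is the addition of an abelian group structure on `α` with unit `zero`. -/
def IsAbelianGroup {α : Type w} (add : α → α → α) (zero : α) : Prop :=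
  ∃ _ : AddCommGroup α, (∀ x y : α, x + y = add x y) ∧ (0 : α) = zero

end Synthetic

/-!
In a chart, parallel transport by a flat connection is a partial action of the first order vectors
`D(n) ⊆ Rⁿ` on pairs of neighbouring points. By the Kock-Lawvere axiom such an action has partial
derivatives `∂ᵢ` on `R`-valued functions; flatness, tested on the Weil algebra of the generic pair
`v, w ∈ D(2)` with `v + w ∈ D(2)`, makes them commute. Moving along `v ∈ D(n)` acts on functions as
`1 + L_v` with `L_v = ∑ vᵢ ∂ᵢ` and `L_v² = 0`, that is, as `exp L_v`, so transport along a chain of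
neighbours with displacements `vₖ` acts as `exp (∑ L_{vₖ})` and depends only on its end points. The
chain starts at an arbitrary stage `c`, where its displacements serve as constant coefficients;
they are constants of the slice topos over `c`, which is where the derivatives are taken.

Path independence of transport makes the codomain of a grid depend only on the end points of the
two paths, so the locally defined codomains glue. Unitality, commutativity and pasting of grids are
then the laws of an abelian heap.
-/

namespace Synthetic

/-- A vector is of first order if all products of its entries vanish, i.e. it lies in the
infinitesimal object `D(n)`. -/
def IsFirstOrder {ι A : Type*} [Mul A] [Zero A] (v : ι → A) : Prop :=
  ∀ i j, v i * v j = 0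

section Algebra

variable {A : Type*} [CommRing A] {n : ℕ}

theorem IsFirstOrder.zero {ι : Type*} : IsFirstOrder (0 : ι → A) := fun _ _ => zero_mul _

theorem IsFirstOrder.map {ι B F : Type*} [CommRing B] [FunLike F A B] [RingHomClass F A B]
    {v : ι → A} (hv : IsFirstOrder v) (f : F) : IsFirstOrder (fun i => f (v i)) := fun i j => by
  rw [← map_mul, hv i j, map_zero]

theorem isFirstOrder_single_add_single {ι : Type*} [DecidableEq ι] {s t : A} (i j : ι)
    (hs : s * s = 0) (ht : t * t = 0) (hst : s * t = 0) :
    IsFirstOrder (Pi.single i s + Pi.single j t : ι → A) := fun k l => by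
  have hts : t * s = 0 := by rw [mul_comm, hst]
  simp only [Pi.add_apply, Pi.single_apply]
  split_ifs <;> simp [mul_add, add_mul, hs, ht, hst, hts]

theorem eval₂_of_isFirstOrder {B : Type*} [CommRing B] (f : A →+* B) {v : Fin n → B}
    (hv : IsFirstOrder v) (P : MvPolynomial (Fin n) A) :
    P.eval₂ f v = f (P.coeff 0) + ∑ i, f (P.coeff (Finsupp.single i 1)) * v i := by
  classical
  induction P using MvPolynomial.induction_on with
  | C a => simp [MvPolynomial.coeff_C, eq_comm (a := (0 : Fin n →₀ ℕ))]
  | add p q hp hq =>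
    simp only [MvPolynomial.eval₂_add, hp, hq, MvPolynomial.coeff_add, map_add, add_mul,
      Finset.sum_add_distrib]
    ring
  | mul_X p j hp =>
    have hcoeff : ∀ i, f ((p * MvPolynomial.X j).coeff (Finsupp.single i 1)) * v i =
        if i = j then f (p.coeff 0) * v i else 0 := fun i => by
      by_cases h : i = j
      · subst h; simp [MvPolynomial.coeff_mul_X']
      · simp [MvPolynomial.coeff_mul_X', h, Ne.symm h]
    rw [MvPolynomial.eval₂_mul, hp, MvPolynomial.eval₂_X, Finset.sum_congr rfl fun i _ => hcoeff i]
    simp [MvPolynomial.coeff_mul_X', add_mul, Finset.sum_mul, mul_assoc, hv _ j]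

theorem isWeilIdeal_sq : IsWeilIdeal
    (Ideal.span (Set.range (MvPolynomial.X : Fin n → MvPolynomial (Fin n) ℚ)) ^ 2) :=
  ⟨Ideal.pow_le_self two_ne_zero, 2, le_rfl⟩

/-- The quadratic equations saying that vectors `(X₀, X₁)` and `(X₂, X₃)` and their sum lie
in `D(2)`. -/
noncomputable def sumPairRelations : Set (MvPolynomial (Fin 4) ℚ) :=
  {.X 0 * .X 0, .X 1 * .X 1, .X 0 * .X 1, .X 2 * .X 2, .X 3 * .X 3, .X 2 * .X 3,
    .X 0 * .X 2, .X 1 * .X 3, .X 0 * .X 3 + .X 1 * .X 2}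

/-- The ideal of the generic pair of vectors of `D(2)` whose sum is in `D(2)`, truncated at
order three so that it is visibly a Weil ideal. -/
noncomputable def sumPairIdeal : Ideal (MvPolynomial (Fin 4) ℚ) :=
  Ideal.span sumPairRelations ⊔ Ideal.span (Set.range MvPolynomial.X) ^ 3

theorem isWeilIdeal_sumPairIdeal : IsWeilIdeal sumPairIdeal := by
  have hX : ∀ i : Fin 4, MvPolynomial.X i ∈
      Ideal.span (Set.range (MvPolynomial.X : Fin 4 → MvPolynomial (Fin 4) ℚ)) :=
    fun i => Ideal.subset_span ⟨i, rfl⟩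
  refine ⟨sup_le (Ideal.span_le.2 fun p hp => ?_) (Ideal.pow_le_self three_ne_zero),
    3, le_sup_right⟩
  rcases hp with rfl | rfl | rfl | rfl | rfl | rfl | rfl | rfl | rfl
  case inr.inr.inr.inr.inr.inr.inr.inr =>
    exact add_mem (Ideal.mul_mem_left _ _ (hX _)) (Ideal.mul_mem_left _ _ (hX _))
  all_goals exact Ideal.mul_mem_left _ _ (hX _)

theorem map_span_range_X {ι B : Type*} [CommRing B] (f : A →+* B) :
    (Ideal.span (Set.range (MvPolynomial.X : ι → MvPolynomial ι A))).map (MvPolynomial.map f) =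
      Ideal.span (Set.range MvPolynomial.X) := by
  rw [Ideal.map_span, ← Set.range_comp]
  congr 2
  exact funext fun i => MvPolynomial.map_X f i

theorem coeff_eq_of_mem_map_sumPairIdeal (f : ℚ →+* A) {P : MvPolynomial (Fin 4) A}
    (hP : P ∈ sumPairIdeal.map (MvPolynomial.map f)) :
    P.coeff (Finsupp.single 0 1 + Finsupp.single 3 1) =
      P.coeff (Finsupp.single 1 1 + Finsupp.single 2 1) := by
  classical
  rw [sumPairIdeal, Ideal.map_sup, Ideal.map_span, Ideal.map_pow, map_span_range_X] at hP
  obtain ⟨p, hp, q, hq, rfl⟩ := Submodule.mem_sup.1 hP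
  have hq' := (MvPolynomial.mem_pow_idealOfVars_iff' 3 q).1 hq
  rw [MvPolynomial.coeff_add, MvPolynomial.coeff_add, hq' _ (by simp), hq' _ (by simp)]
  clear hP
  suffices ∀ r, (r * p).coeff (Finsupp.single 0 1 + Finsupp.single 3 1) =
      (r * p).coeff (Finsupp.single 1 1 + Finsupp.single 2 1) by simpa using this 1
  induction hp using Submodule.span_induction with
  | zero => simp
  | add p q _ _ hp hq => simp [mul_add, hp, hq]
  | smul a p _ hp => intro r; simpa [mul_assoc] using hp (r * a)
  | mem p hp =>
    intro r
    obtain ⟨p, hp, rfl⟩ := hp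
    rcases hp with rfl | rfl | rfl | rfl | rfl | rfl | rfl | rfl | rfl <;>
      simp [mul_add, ← mul_assoc, MvPolynomial.coeff_mul_X']

end Algebra

section KockLawvere

variable {C : Type u} [Category.{v} C] {J : GrothendieckTopology C}

/-- The scalars at stage `c`. -/
abbrev LineObject.At (R : LineObject.{r} J) (c : C) : Type r := R.ring.obj (op c)

/-- Restriction of scalars. -/
abbrev LineObject.res (R : LineObject.{r} J) {c d : C} (f : d ⟶ c) : R.At c →ₐ[ℚ] R.At d :=
  scalarRes R.ring f

theorem LineObject.res_comp (R : LineObject.{r} J) {c d e : C} (g : d ⟶ c) (h : e ⟶ d)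
    (x : R.At c) : R.res (h ≫ g) x = R.res h (R.res g x) := by
  simp [LineObject.res, scalarRes]

theorem LineObject.res_id (R : LineObject.{r} J) {c : C} (x : R.At c) : R.res (𝟙 c) x = x := by
  simp [LineObject.res, scalarRes]

variable {R : LineObject.{r} J} {c : C} {n : ℕ}

theorem mem_weilSpec_sq_iff {v : Fin n → R.At c} :
    v ∈ weilSpec R.ring (Ideal.span (Set.range MvPolynomial.X) ^ 2) c ↔ IsFirstOrder v := by
  change Ideal.span (Set.range MvPolynomial.X) ^ 2 ≤
    RingHom.ker (MvPolynomial.aeval v : MvPolynomial (Fin n) ℚ →ₐ[ℚ] R.At c) ↔ _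
  rw [sq, Ideal.span_mul_span', Ideal.span_le]
  constructor
  · intro h i j
    simpa [RingHom.mem_ker] using h (Set.mul_mem_mul (Set.mem_range_self i) (Set.mem_range_self j))
  · rintro hv _ ⟨_, ⟨i, rfl⟩, _, ⟨j, rfl⟩, rfl⟩
    simpa [RingHom.mem_ker] using hv i j

theorem exists_linear_expansion
    (F : ∀ {d : C} (_ : d ⟶ c) (v : Fin n → R.At d), IsFirstOrder v → R.At d)
    (hF : ∀ {d e : C} (g : d ⟶ c) (h : e ⟶ d) (v : Fin n → R.At d) (hv : IsFirstOrder v),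
      F (h ≫ g) (fun i => R.res h (v i)) (hv.map (R.res h)) = R.res h (F g v hv)) :
    ∃ a : Fin n → R.At c, ∀ {d : C} (g : d ⟶ c) (v : Fin n → R.At d) (hv : IsFirstOrder v),
      F g v hv = R.res g (F (𝟙 c) 0 .zero) + ∑ i, R.res g (a i) * v i := by
  classical
  obtain ⟨P, hP⟩ := R.kl_exists _ (isWeilIdeal_sq (n := n)) c
    { toFun := fun g v => if hv : IsFirstOrder v then F g v hv else 0
      natural := fun g h v hv => by
        have hv := mem_weilSpec_sq_iff.1 hv
        rw [dif_pos hv, dif_pos (hv.map (R.res h)), hF] }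
  have hF_eq : ∀ {d : C} (g : d ⟶ c) (v : Fin n → R.At d) (hv : IsFirstOrder v),
      F g v hv = R.res g (P.coeff 0) + ∑ i, R.res g (P.coeff (Finsupp.single i 1)) * v i :=
    fun g v hv => by
      have := hP g v (mem_weilSpec_sq_iff.2 hv)
      rw [evalAt, eval₂_of_isFirstOrder _ hv] at this
      exact (dif_pos hv).symm.trans this
  refine ⟨fun i => P.coeff (Finsupp.single i 1), fun g v hv => ?_⟩
  rw [hF_eq g v hv, hF_eq (𝟙 c) 0 .zero]
  simp [LineObject.res_id]

theorem linear_ext {a b : Fin n → R.At c}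
    (h : ∀ {d : C} (g : d ⟶ c) (v : Fin n → R.At d), IsFirstOrder v →
      ∑ i, R.res g (a i) * v i = ∑ i, R.res g (b i) * v i) : a = b := by
  let P : MvPolynomial (Fin n) (R.At c) := ∑ i, .monomial (Finsupp.single i 1) (a i - b i)
  have hP := R.kl_unique _ isWeilIdeal_sq c P fun g v hv => by
    have := sub_eq_zero.2 (h g v (mem_weilSpec_sq_iff.1 hv))
    rw [← Finset.sum_sub_distrib] at this
    simpa [evalAt, P, MvPolynomial.eval₂_sum, sub_mul] using this
  rw [Ideal.map_pow, map_span_range_X] at hP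
  have hcoeff := (MvPolynomial.mem_pow_idealOfVars_iff' 2 P).1 hP
  funext i
  rw [← sub_eq_zero]
  simpa [P, MvPolynomial.coeff_sum, MvPolynomial.coeff_monomial,
    Finsupp.single_left_inj (one_ne_zero (α := ℕ))] using hcoeff (Finsupp.single i 1) (by simp)

theorem bilinear_symm_of_add_isFirstOrder (b : Fin n → Fin n → R.At c)
    (hb : ∀ {d : C} (g : d ⟶ c) (v w : Fin n → R.At d), IsFirstOrder v → IsFirstOrder w →
      IsFirstOrder (v + w) → ∑ i, ∑ j, R.res g (b i j) * (v i * w j) = 0) (i j : Fin n) :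
    b i j = b j i := by
  classical
  let P : MvPolynomial (Fin 4) (R.At c) :=
    MvPolynomial.C (b i j) * (.X 0 * .X 3) + MvPolynomial.C (b j i) * (.X 1 * .X 2)
  have hP := R.kl_unique _ isWeilIdeal_sumPairIdeal c P fun {d} g x hx => by
    have hrel : ∀ p ∈ sumPairRelations, MvPolynomial.aeval x p = 0 :=
      fun p hp => hx p (le_sup_left (a := Ideal.span sumPairRelations) (Ideal.subset_span hp))
    simp only [sumPairRelations, Set.forall_mem_insert, Set.mem_singleton_iff, forall_eq, map_mul,
      map_add, MvPolynomial.aeval_X] at hrel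
    obtain ⟨h00, h11, h01, h22, h33, h23, h02, h13, h0312⟩ := hrel
    have hv : IsFirstOrder (Pi.single i (x 0) + Pi.single j (x 1) : Fin n → R.At d) :=
      isFirstOrder_single_add_single i j h00 h11 h01
    have hw : IsFirstOrder (Pi.single i (x 2) + Pi.single j (x 3) : Fin n → R.At d) :=
      isFirstOrder_single_add_single i j h22 h33 h23
    have hvw : IsFirstOrder (Pi.single i (x 0) + Pi.single j (x 1) +
        (Pi.single i (x 2) + Pi.single j (x 3)) : Fin n → R.At d) := by
      rw [add_add_add_comm, ← Pi.single_add, ← Pi.single_add]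
      exact isFirstOrder_single_add_single i j (by linear_combination h00 + h22 + 2 * h02)
        (by linear_combination h11 + h33 + 2 * h13) (by linear_combination h01 + h23 + h0312)
    have := hb g _ _ hv hw hvw
    simp only [Pi.add_apply, Pi.single_apply, add_mul, mul_add, ite_mul, mul_ite, zero_mul,
      mul_zero, Finset.sum_add_distrib, Finset.sum_ite_eq', Finset.mem_univ, if_true, h02,
      h13] at this
    rw [add_comm] at this
    simpa [evalAt, P] using this
  have := coeff_eq_of_mem_map_sumPairIdeal _ hP
  simpa [P, mul_add, ← mul_assoc, MvPolynomial.coeff_mul_X'] using this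

end KockLawvere

section Slice

variable {C : Type u} [Category.{v} C] {J : GrothendieckTopology C}

/-- The line object of the slice topos over the stage `c`: the scalars at `f : d ⟶ c` are those
at `d`. In the slice, `c` becomes a terminal stage. -/
def LineObject.over (R : LineObject.{r} J) (c : C) : LineObject.{r} (J.over c) where
  ring := (Over.forget c).op ⋙ R.ring
  isSheaf := (Sheaf.over ⟨_, R.isSheaf⟩ c).property
  kl_exists I hI Y f := by
    obtain ⟨P, hP⟩ := R.kl_exists I hI Y.left
      { toFun := fun g => f.toFun (Over.homMk g : Over.mk (g ≫ Y.hom) ⟶ Y)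
        natural := fun {d e} g h v hv => by
          have hhg : (Over.homMk h (by simp) :
              Over.mk ((h ≫ g) ≫ Y.hom) ⟶ Over.mk (g ≫ Y.hom)) ≫ Over.homMk g =
                (Over.homMk (h ≫ g) : Over.mk ((h ≫ g) ≫ Y.hom) ⟶ Y) := rfl
          rw [← hhg]
          exact f.natural (c' := Over.mk (g ≫ Y.hom)) (c'' := Over.mk ((h ≫ g) ≫ Y.hom)) _ _ v hv }
    refine ⟨P, fun {Z} g v hv => Eq.trans ?_ (hP g.left v hv)⟩
    let k : Over.mk (g.left ≫ Y.hom) ⟶ Y := Over.homMk g.left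
    let h : Z ⟶ Over.mk (g.left ≫ Y.hom) := Over.homMk (𝟙 Z.left) (by simp)
    have hk : h ≫ k = g := by ext; simp [h, k]
    have hv' : (fun i => R.res (𝟙 Z.left) (v i)) = v := funext fun i => R.res_id (v i)
    have hnat := f.natural k h v hv
    rw [hk] at hnat
    exact (congrArg (f.toFun g) hv').symm.trans (hnat.trans (R.res_id _))
  kl_unique I hI Y P hP := R.kl_unique I hI Y.left P fun g v hv =>
    hP (Over.homMk g : Over.mk (g ≫ Y.hom) ⟶ Y) v hv

end Slice

section InfinitesimalAction

variable {C : Type u} [Category.{v} C] {J : GrothendieckTopology C}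

/-- A partial action of `Rⁿ` on a presheaf `T`: points can be moved by first order vectors, and
moving twice is moving by the sum whenever that sum is again of first order. -/
structure InfinitesimalAction (R : LineObject.{r} J) (n : ℕ) (T : Cᵒᵖ ⥤ Type w) where
  act : ∀ {c : C} (v : Fin n → R.At c), IsFirstOrder v → T.obj (op c) → T.obj (op c)
  act_res : ∀ {c d : C} (h : d ⟶ c) (v : Fin n → R.At c) (hv : IsFirstOrder v) (p : T.obj (op c)),
    act (fun i => R.res h (v i)) (hv.map (R.res h)) (T.map h.op p) = T.map h.op (act v hv p)
  act_zero : ∀ {c : C} (p : T.obj (op c)), act 0 .zero p = p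
  act_add : ∀ {c : C} (v w : Fin n → R.At c) (hv : IsFirstOrder v) (hw : IsFirstOrder w)
    (hvw : IsFirstOrder (v + w)) (p : T.obj (op c)), act w hw (act v hv p) = act (v + w) hvw p

/-- The `ℚ`-algebra of maps `T → R` in the topos. -/
def functionAlgebra (R : LineObject.{r} J) (T : Cᵒᵖ ⥤ Type w) :
    Subalgebra ℚ (∀ c : C, T.obj (op c) → R.At c) where
  carrier := {f | ∀ {c d : C} (h : d ⟶ c) (p : T.obj (op c)), f d (T.map h.op p) = R.res h (f c p)}
  mul_mem' hf hg _ _ h p := by simp [hf h p, hg h p]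
  add_mem' hf hg _ _ h p := by simp [hf h p, hg h p]
  algebraMap_mem' _ _ _ h _ := ((R.res h).commutes _).symm

namespace InfinitesimalAction

variable {R : LineObject.{r} J} {n : ℕ} {T : Cᵒᵖ ⥤ Type w} (Φ : InfinitesimalAction R n T)
  (f : functionAlgebra R T)

theorem exists_gradient {c : C} (p : T.obj (op c)) : ∃ a : Fin n → R.At c,
    ∀ {d : C} (g : d ⟶ c) (v : Fin n → R.At d) (hv : IsFirstOrder v),
      f.1 d (Φ.act v hv (T.map g.op p)) = R.res g (f.1 c p) + ∑ i, R.res g (a i) * v i := by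
  obtain ⟨a, ha⟩ := exists_linear_expansion
    (fun {d} g v hv => f.1 d (Φ.act v hv (T.map g.op p))) fun g h v hv => by
      rw [← f.2 h, ← Φ.act_res, op_comp, Functor.map_comp_apply]
  refine ⟨a, fun g v hv => ?_⟩
  rw [ha g v hv, Φ.act_zero, op_id, Functor.map_id_apply]

/-- The vector of partial derivatives of `f` along the action. -/
noncomputable def gradient {c : C} (p : T.obj (op c)) : Fin n → R.At c :=
  (Φ.exists_gradient f p).choose

theorem apply_act_res {c d : C} (p : T.obj (op c)) (g : d ⟶ c) (v : Fin n → R.At d)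
    (hv : IsFirstOrder v) : f.1 d (Φ.act v hv (T.map g.op p)) =
      R.res g (f.1 c p) + ∑ i, R.res g (Φ.gradient f p i) * v i :=
  (Φ.exists_gradient f p).choose_spec g v hv

theorem gradient_eq {c : C} (p : T.obj (op c)) {a : Fin n → R.At c}
    (ha : ∀ {d : C} (g : d ⟶ c) (v : Fin n → R.At d) (hv : IsFirstOrder v),
      f.1 d (Φ.act v hv (T.map g.op p)) = R.res g (f.1 c p) + ∑ i, R.res g (a i) * v i) :
    Φ.gradient f p = a :=
  linear_ext fun g v hv => add_left_cancel ((Φ.apply_act_res f p g v hv).symm.trans (ha g v hv))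

theorem gradient_res {c d : C} (h : d ⟶ c) (p : T.obj (op c)) (i : Fin n) :
    Φ.gradient f (T.map h.op p) i = R.res h (Φ.gradient f p i) := by
  refine congrFun (Φ.gradient_eq f (T.map h.op p) (a := fun i => R.res h (Φ.gradient f p i))
    fun g v hv => ?_) i
  rw [← Functor.map_comp_apply, ← op_comp, Φ.apply_act_res, f.2 h]
  simp only [R.res_comp]

theorem gradient_add (f g : functionAlgebra R T) {c : C} (p : T.obj (op c)) :
    Φ.gradient (f + g) p = Φ.gradient f p + Φ.gradient g p :=
  Φ.gradient_eq (f + g) p fun h v hv => by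
    change f.1 _ _ + g.1 _ _ = R.res h (f.1 _ _ + g.1 _ _) + _
    rw [Φ.apply_act_res, Φ.apply_act_res]
    simp only [Pi.add_apply, map_add, add_mul, Finset.sum_add_distrib]
    ring

/-- The partial derivative along the `i`-th coordinate of the action. -/
noncomputable def partialDeriv (i : Fin n) : Module.End ℚ (functionAlgebra R T) :=
  (AddMonoidHom.mk'
    (fun f => (⟨fun _ p => Φ.gradient f p i, fun h p => Φ.gradient_res f h p i⟩ :
      functionAlgebra R T))
    fun f g => Subtype.ext (funext fun _ => funext fun p =>
      congrFun (Φ.gradient_add f g p) i)).toRatLinearMap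

theorem apply_act {c : C} (p : T.obj (op c)) (v : Fin n → R.At c) (hv : IsFirstOrder v) :
    f.1 c (Φ.act v hv p) = f.1 c p + ∑ i, (Φ.partialDeriv i f).1 c p * v i := by
  have := Φ.apply_act_res f p (𝟙 c) v hv
  rw [op_id, Functor.map_id_apply] at this
  simp only [R.res_id] at this
  exact this

theorem partialDeriv_comm (i j : Fin n) :
    Commute (Φ.partialDeriv i) (Φ.partialDeriv j) := by
  refine LinearMap.ext fun f => Subtype.ext (funext fun c => funext fun p => ?_)
  refine bilinear_symm_of_add_isFirstOrder
    (fun i j => (Φ.partialDeriv i (Φ.partialDeriv j f)).1 c p) (fun g v w hv hw hvw => ?_) i j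
  have hact := congrArg (f.1 _) (Φ.act_add v w hv hw hvw (T.map g.op p))
  simp only [Φ.apply_act, add_mul, Finset.sum_mul, Pi.add_apply, mul_add,
    Finset.sum_add_distrib] at hact
  rw [Finset.sum_comm]
  simp only [← (Φ.partialDeriv _ _).2 g, ← mul_assoc]
  linear_combination hact

section Exponential

variable {t : C} (ht : Limits.IsTerminal t)

variable (R T) in
/-- Multiplication of functions by global scalars, i.e. by scalars at a terminal stage. -/
noncomputable def scalarMul : R.At t →+* Module.End ℚ (functionAlgebra R T) :=
  (Algebra.lmul ℚ (functionAlgebra R T)).toRingHom.comp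
    { toFun := fun a => ⟨fun c _ => R.res (ht.from c) a, fun {c d} h _ => by
        rw [← R.res_comp, ht.hom_ext (h ≫ ht.from c) (ht.from d)]⟩
      map_one' := Subtype.ext (funext fun c => funext fun _ => map_one (R.res (ht.from c)))
      map_zero' := Subtype.ext (funext fun c => funext fun _ => map_zero (R.res (ht.from c)))
      map_mul' := fun a b => Subtype.ext (funext fun c => funext fun _ =>
        map_mul (R.res (ht.from c)) a b)
      map_add' := fun a b => Subtype.ext (funext fun c => funext fun _ =>
        map_add (R.res (ht.from c)) a b) }

theorem scalarMul_apply (a : R.At t) {c : C} (p : T.obj (op c)) :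
    (scalarMul R T ht a f).1 c p = R.res (ht.from c) a * f.1 c p :=
  rfl

theorem scalarMul_partialDeriv_comm (a : R.At t) (i : Fin n) :
    Commute (scalarMul R T ht a) (Φ.partialDeriv i) := by
  refine LinearMap.ext fun f => Subtype.ext (funext fun c => funext fun p => ?_)
  refine (congrFun (Φ.gradient_eq (scalarMul R T ht a f) p
    (a := fun i => R.res (ht.from c) a * Φ.gradient f p i) fun {d} g v hv => ?_) i).symm
  rw [scalarMul_apply, scalarMul_apply, Φ.apply_act_res, ht.hom_ext (ht.from d) (g ≫ ht.from c)]
  simp only [R.res_comp, map_mul, mul_add, Finset.mul_sum, mul_assoc]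

/-- The derivative `∑ vᵢ ∂ᵢ` in the direction of a global vector. -/
noncomputable def lieDerivative (v : Fin n → R.At t) : Module.End ℚ (functionAlgebra R T) :=
  ∑ i, scalarMul R T ht (v i) * Φ.partialDeriv i

theorem lieDerivative_zero : Φ.lieDerivative ht 0 = 0 := by
  simp [lieDerivative]

theorem lieDerivative_add (v w : Fin n → R.At t) :
    Φ.lieDerivative ht (v + w) = Φ.lieDerivative ht v + Φ.lieDerivative ht w := by
  simp [lieDerivative, add_mul, Finset.sum_add_distrib]

theorem lieDerivative_mul (v w : Fin n → R.At t) : Φ.lieDerivative ht v * Φ.lieDerivative ht w =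
    ∑ i, ∑ j, scalarMul R T ht (v i * w j) * (Φ.partialDeriv i * Φ.partialDeriv j) := by
  rw [lieDerivative, lieDerivative, Finset.sum_mul_sum]
  refine Finset.sum_congr rfl fun i _ => Finset.sum_congr rfl fun j _ => ?_
  rw [map_mul, (Φ.scalarMul_partialDeriv_comm ht (w j) i).symm.mul_mul_mul_comm]

theorem lieDerivative_comm (v w : Fin n → R.At t) :
    Commute (Φ.lieDerivative ht v) (Φ.lieDerivative ht w) := by
  rw [commute_iff_eq, lieDerivative_mul, lieDerivative_mul, Finset.sum_comm]
  simp only [mul_comm (v _), (Φ.partialDeriv_comm _ _).eq]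

theorem lieDerivative_sq {v : Fin n → R.At t} (hv : IsFirstOrder v) :
    Φ.lieDerivative ht v ^ 2 = 0 := by
  rw [sq, lieDerivative_mul]
  simp [hv _ _]

theorem exp_lieDerivative_apply {v : Fin n → R.At t} (hv : IsFirstOrder v) (p : T.obj (op t)) :
    f.1 t (Φ.act v hv p) = (IsNilpotent.exp (Φ.lieDerivative ht v) f).1 t p := by
  rw [IsNilpotent.exp_eq_sum (Φ.lieDerivative_sq ht hv), Φ.apply_act]
  have hlie : (Φ.lieDerivative ht v f).1 t p = ∑ i, v i * (Φ.partialDeriv i f).1 t p := by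
    simp [lieDerivative, Finset.sum_apply, scalarMul_apply, R.res_id]
  simp only [Finset.sum_range_succ]
  simp [hlie, mul_comm]

/-- `Φ.Reaches v p q`: a sequence of first order moves with total displacement `v` takes `p`
to `q`. -/
inductive Reaches (p : T.obj (op t)) : (Fin n → R.At t) → T.obj (op t) → Prop
  | refl : Reaches p 0 p
  | step {v w : Fin n → R.At t} {q : T.obj (op t)} (h : Reaches p v q) (hw : IsFirstOrder w) :
    Reaches p (v + w) (Φ.act w hw q)

variable {Φ}

theorem Reaches.isNilpotent {p q : T.obj (op t)} {v : Fin n → R.At t} (h : Φ.Reaches p v q) :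
    IsNilpotent (Φ.lieDerivative ht v) := by
  induction h with
  | refl => rw [lieDerivative_zero]; exact .zero
  | step _ hw ih =>
    rw [lieDerivative_add]
    exact (Φ.lieDerivative_comm ht _ _).isNilpotent_add ih ⟨2, Φ.lieDerivative_sq ht hw⟩

theorem Reaches.apply_eq {p q : T.obj (op t)} {v : Fin n → R.At t} (h : Φ.Reaches p v q)
    (f : functionAlgebra R T) : f.1 t q = (IsNilpotent.exp (Φ.lieDerivative ht v) f).1 t p := by
  induction h generalizing f with
  | refl => simp [lieDerivative_zero]
  | step h hw ih =>
    rw [Φ.exp_lieDerivative_apply f ht hw, ih, lieDerivative_add,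
      IsNilpotent.exp_add_of_commute (Φ.lieDerivative_comm ht _ _) (h.isNilpotent ht)
        ⟨2, Φ.lieDerivative_sq ht hw⟩]
    rfl

end Exponential

end InfinitesimalAction
end InfinitesimalAction

section Neighbours

variable {C : Type u} [Category.{v} C] {J : GrothendieckTopology C} {M : NeighbourSpace.{w} J}

theorem NeighbourSpace.res_comp (M : NeighbourSpace.{w} J) {c d e : C} (g : d ⟶ c) (h : e ⟶ d)
    (x : M.Pt c) : M.res (h ≫ g) x = M.res h (M.res g x) := by
  simp [NeighbourSpace.res]

theorem NeighbourSpace.res_id (M : NeighbourSpace.{w} J) {c : C} (x : M.Pt c) :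
    M.res (𝟙 c) x = x := by
  simp [NeighbourSpace.res]

theorem NeighbourSpace.eq_of_locally_eq (M : NeighbourSpace.{w} J) {c : C} {S : Sieve c}
    (hS : S ∈ J c) {x y : M.Pt c} (h : ∀ {d : C} (f : d ⟶ c), S f → M.res f x = M.res f y) :
    x = y :=
  (((isSheaf_iff_isSheaf_of_type _ _).1 M.sheaf.property).isSeparated S hS).ext fun _ f hf => h f hf

theorem NeighbourSpace.IsPath.res {c d : C} (f : d ⟶ c) {n : ℕ} {p : ℕ → M.Pt c} {a b : M.Pt c}
    (h : M.IsPath n p a b) : M.IsPath n (fun i => M.res f (p i)) (M.res f a) (M.res f b) :=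
  ⟨congrArg _ h.1, congrArg _ h.2.1, fun i hi => M.near_res f (h.2.2 i hi)⟩

end Neighbours

section Chart

variable {C : Type u} [Category.{v} C] {J : GrothendieckTopology C}

namespace Chart

variable {R : LineObject.{r} J} {M : NeighbourSpace.{w} J} {c : C} (φ : Chart R M c)
  {d e : C} {g : d ⟶ c}

/-- Restriction of points of the domain of a chart; the structure map of the new stage is only
required to be propositionally equal to the composite. -/
def restrict (h : e ⟶ d) {k : e ⟶ c} (hk : h ≫ g = k) (x : φ.domain g) : φ.domain k :=
  ⟨M.res h x.1, hk ▸ φ.domain_res g h x.2⟩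

theorem coord_restrict (h : e ⟶ d) {k : e ⟶ c} (hk : h ≫ g = k) (x : φ.domain g) :
    φ.coord k (φ.restrict h hk x) = fun i => R.res h (φ.coord g x i) := by
  subst hk
  exact funext (φ.coord_res g h x)

theorem exists_coord_eq_add (x : φ.domain g) {v : Fin φ.dim → R.At d} (hv : IsFirstOrder v) :
    ∃ y : φ.domain g, φ.coord g y = φ.coord g x + v :=
  φ.coord_open g x _ fun i j => by simpa using hv i j

/-- The point whose coordinates differ from those of `x` by the first order vector `v`. -/
noncomputable def translate (x : φ.domain g) (v : Fin φ.dim → R.At d) (hv : IsFirstOrder v) :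
    φ.domain g :=
  (φ.exists_coord_eq_add x hv).choose

variable {v w : Fin φ.dim → R.At d}

theorem coord_translate (x : φ.domain g) (hv : IsFirstOrder v) :
    φ.coord g (φ.translate x v hv) = φ.coord g x + v :=
  (φ.exists_coord_eq_add x hv).choose_spec

theorem translate_eq {x y : φ.domain g} (hv : IsFirstOrder v)
    (h : φ.coord g y = φ.coord g x + v) : φ.translate x v hv = y :=
  φ.coord_injective g ((φ.coord_translate x hv).trans h.symm)

theorem translate_zero (x : φ.domain g) : φ.translate x 0 .zero = x :=
  φ.translate_eq .zero (add_zero _).symm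

theorem translate_add (x : φ.domain g) (hv : IsFirstOrder v) (hw : IsFirstOrder w)
    (hvw : IsFirstOrder (v + w)) :
    φ.translate (φ.translate x v hv) w hw = φ.translate x (v + w) hvw :=
  φ.translate_eq hw (by rw [coord_translate, coord_translate, add_assoc])

theorem restrict_translate (h : e ⟶ d) {k : e ⟶ c} (hk : h ≫ g = k) (x : φ.domain g)
    (hv : IsFirstOrder v) : φ.restrict h hk (φ.translate x v hv) =
      φ.translate (φ.restrict h hk x) (fun i => R.res h (v i)) (hv.map (R.res h)) := by
  refine (φ.translate_eq _ ?_).symm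
  rw [coord_restrict, coord_restrict, coord_translate]
  exact funext fun i => map_add (R.res h) _ _

theorem near_iff {x y : φ.domain g} :
    M.near x.1 y.1 ↔ IsFirstOrder (φ.coord g y - φ.coord g x) :=
  φ.coord_near g x y

theorem near_translate (x : φ.domain g) (hv : IsFirstOrder v) :
    M.near x.1 (φ.translate x v hv).1 := by
  rwa [near_iff, coord_translate, add_sub_cancel_left]

/-- A pair of neighbouring points in the domain of a chart, thought of as a tangent vector with
the given foot. -/
@[ext]
structure TangentPair (g : d ⟶ c) where
  foot : φ.domain g
  tip : φ.domain g
  near : M.near foot.1 tip.1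

/-- The presheaf of tangent pairs on the stages over `c`. -/
def tangentPairs : (Over c)ᵒᵖ ⥤ Type w where
  obj Y := φ.TangentPair Y.unop.hom
  map h := TypeCat.ofHom fun p =>
    { foot := φ.restrict h.unop.left (Over.w h.unop) p.foot
      tip := φ.restrict h.unop.left (Over.w h.unop) p.tip
      near := M.near_res h.unop.left p.near }
  map_id Y := by
    ext p
    exacts [M.res_id _, M.res_id _]
  map_comp h k := by
    ext p
    exacts [M.res_comp _ _ _, M.res_comp _ _ _]

/-- The coordinates of the tip, as functions on tangent pairs. -/
def tipCoord (i : Fin φ.dim) : functionAlgebra (R.over c) φ.tangentPairs :=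
  ⟨fun Y p => φ.coord Y.hom p.tip i, fun h p =>
    congrFun (φ.coord_restrict h.left (Over.w h) p.tip) i⟩

variable {L : AffineConnection M}

/-- Parallel transport of tangent pairs, by a flat connection, along first order translations
of their feet. -/
noncomputable def transport (hflat : L.IsFlat) :
    InfinitesimalAction (R.over c) φ.dim φ.tangentPairs where
  act {Y} v hv p :=
    have hnear := L.near_right p.tip.1 p.foot.1 (φ.translate p.foot v hv).1
      (φ.near_translate p.foot hv) p.near
    { foot := φ.translate p.foot v hv
      tip := ⟨L.op p.tip.1 p.foot.1 (φ.translate p.foot v hv).1,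
        φ.domain_open Y.hom (φ.translate p.foot v hv).2 (M.near_symm hnear)⟩
      near := M.near_symm hnear }
  act_res h v hv p := by
    have hfoot := φ.restrict_translate h.left (Over.w h) p.foot hv
    refine TangentPair.ext hfoot.symm (Subtype.ext ?_)
    exact (congrArg (L.op _ _) (congrArg Subtype.val hfoot.symm)).trans
      (L.op_res h.left _ _ _ (φ.near_translate p.foot hv) p.near).symm
  act_zero p := TangentPair.ext (φ.translate_zero p.foot) (Subtype.ext
    ((congrArg (L.op _ _) (congrArg Subtype.val (φ.translate_zero p.foot))).trans
      (L.unit_left _ _ p.near)))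
  act_add v w hv hw hvw p := by
    have hfoot := φ.translate_add p.foot hv hw hvw
    refine TangentPair.ext hfoot (Subtype.ext ?_)
    have hnear : M.near p.foot.1 (φ.translate (φ.translate p.foot v hv) w hw).1 :=
      hfoot ▸ φ.near_translate p.foot hvw
    exact (hflat _ _ _ _ (φ.near_translate _ hv) (φ.near_translate _ hw) hnear p.near).trans
      (congrArg (L.op _ _) (congrArg Subtype.val hfoot))

variable {p q : ℕ → M.Pt c} {n m : ℕ}

theorem exists_reaches (hflat : L.IsFlat) (o : φ.TangentPair (𝟙 c)) (h0 : p 0 = o.foot.1)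
    (hp : ∀ i < n, M.near (p i) (p (i + 1))) : ∃ e : φ.TangentPair (𝟙 c),
      e.foot.1 = p n ∧ e.tip.1 = gridStep L.op p o.tip.1 n ∧
        (φ.transport hflat).Reaches (t := Over.mk (𝟙 c)) o
          (φ.coord (𝟙 c) e.foot - φ.coord (𝟙 c) o.foot) e := by
  induction n with
  | zero => exact ⟨o, h0.symm, rfl, by rw [sub_self]; exact .refl⟩
  | succ n ih =>
    obtain ⟨e, hfoot, htip, hreach⟩ := ih fun i hi => hp i (by omega)
    have hnear : M.near e.foot.1 (p (n + 1)) := hfoot ▸ hp n (by omega)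
    let x : φ.domain (𝟙 c) := ⟨p (n + 1), φ.domain_open _ e.foot.2 hnear⟩
    have hv : IsFirstOrder (φ.coord (𝟙 c) x - φ.coord (𝟙 c) e.foot) := φ.near_iff.1 hnear
    have hx : φ.translate e.foot _ hv = x := φ.translate_eq hv (add_sub_cancel _ _).symm
    refine ⟨(φ.transport hflat).act (c := Over.mk (𝟙 c)) _ hv e, congrArg Subtype.val hx, ?_, ?_⟩
    · rw [gridStep, ← htip, ← hfoot]
      exact congrArg (L.op _ _) (congrArg Subtype.val hx)
    · have hsum : φ.coord (𝟙 c) (φ.translate e.foot _ hv) - φ.coord (𝟙 c) o.foot =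
          (φ.coord (𝟙 c) e.foot - φ.coord (𝟙 c) o.foot) +
            (φ.coord (𝟙 c) x - φ.coord (𝟙 c) e.foot) := by
        rw [coord_translate]
        abel
      exact hsum ▸ hreach.step hv

theorem tip_eq_of_reaches (hflat : L.IsFlat) {o e e' : φ.TangentPair (𝟙 c)}
    {v : Fin φ.dim → R.At c} (h : (φ.transport hflat).Reaches (t := Over.mk (𝟙 c)) o v e)
    (h' : (φ.transport hflat).Reaches (t := Over.mk (𝟙 c)) o v e') : e.tip = e'.tip :=
  φ.coord_injective (𝟙 c) <| funext fun i =>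
    (h.apply_eq Over.mkIdTerminal (φ.tipCoord i)).trans
      (h'.apply_eq Over.mkIdTerminal (φ.tipCoord i)).symm

theorem gridStep_eq (hflat : L.IsFlat) {x y a : M.Pt c} (hx : x ∈ φ.domain (𝟙 c))
    (ha : M.near x a) (hp : M.IsPath n p x y) (hq : M.IsPath m q x y) :
    gridStep L.op p a n = gridStep L.op q a m := by
  let o : φ.TangentPair (𝟙 c) := ⟨⟨x, hx⟩, ⟨a, φ.domain_open _ hx ha⟩, ha⟩
  obtain ⟨e, hfoot, htip, hreach⟩ := φ.exists_reaches hflat o hp.1 hp.2.2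
  obtain ⟨e', hfoot', htip', hreach'⟩ := φ.exists_reaches hflat o hq.1 hq.2.2
  have hee' : e.foot = e'.foot :=
    Subtype.ext (hfoot.trans ((hp.2.1.trans hq.2.1.symm).trans hfoot'.symm))
  rw [← hee'] at hreach'
  rw [← htip, ← htip', φ.tip_eq_of_reaches hflat hreach hreach']

end Chart
end Chart

section Transport

variable {C : Type u} [Category.{v} C] {J : GrothendieckTopology C} {M : NeighbourSpace.{w} J}
  {L : AffineConnection M} {c d : C} {p : ℕ → M.Pt c} {a x y : M.Pt c} {n : ℕ}

theorem gridStep_congr {α : Type*} {op : α → α → α → α} {p q : ℕ → α} {a : α} {n : ℕ}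
    (h : ∀ i ≤ n, p i = q i) : gridStep op p a n = gridStep op q a n := by
  induction n with
  | zero => rfl
  | succ n ih =>
    rw [gridStep, gridStep, ih fun i hi => h i (by omega), h n (by omega), h (n + 1) le_rfl]

theorem gridStep_add {α : Type*} {op : α → α → α → α} {p : ℕ → α} {a : α} (n j : ℕ) :
    gridStep op p a (n + j) = gridStep op (fun k => p (n + k)) (gridStep op p a n) j := by
  induction j with
  | zero => rfl
  | succ j ih => rw [← add_assoc, gridStep, ih, gridStep, add_assoc]

theorem AffineConnection.near_gridStep (L : AffineConnection M) (ha : M.near (p 0) a)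
    (hp : ∀ i < n, M.near (p i) (p (i + 1))) : M.near (p n) (gridStep L.op p a n) := by
  induction n with
  | zero => exact ha
  | succ n ih =>
    exact M.near_symm (L.near_right _ _ _ (hp n (by omega)) (ih fun i hi => hp i (by omega)))

theorem AffineConnection.near_gridStep_succ (L : AffineConnection M) (ha : M.near (p 0) a)
    (hp : ∀ i < n, M.near (p i) (p (i + 1))) {i : ℕ} (hi : i < n) :
    M.near (gridStep L.op p a i) (gridStep L.op p a (i + 1)) :=
  M.near_symm (L.near_left _ _ _ (hp i hi) (L.near_gridStep ha fun j hj => hp j (by omega)))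

theorem AffineConnection.res_gridStep (L : AffineConnection M) (f : d ⟶ c) (ha : M.near (p 0) a)
    (hp : ∀ i < n, M.near (p i) (p (i + 1))) :
    M.res f (gridStep L.op p a n) = gridStep L.op (fun i => M.res f (p i)) (M.res f a) n := by
  induction n with
  | zero => rfl
  | succ n ih =>
    have hp' : ∀ i < n, M.near (p i) (p (i + 1)) := fun i hi => hp i (by omega)
    rw [gridStep, L.op_res f _ _ _ (hp n (by omega)) (L.near_gridStep ha hp'), ih hp']
    rfl

theorem AffineConnection.IsFlat.gridStep_eq {R : LineObject.{r} J} (hM : IsManifold R M)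
    (hflat : L.IsFlat) {m : ℕ} {q : ℕ → M.Pt c} (hp : M.IsPath n p x y) (hq : M.IsPath m q x y)
    (ha : M.near x a) : gridStep L.op p a n = gridStep L.op q a m := by
  obtain ⟨S, hS, hφ⟩ := hM c x
  refine M.eq_of_locally_eq hS fun f hf => ?_
  obtain ⟨φ, hx⟩ := hφ f hf
  rw [L.res_gridStep f (hp.1 ▸ ha) hp.2.2, L.res_gridStep f (hq.1 ▸ ha) hq.2.2]
  exact φ.gridStep_eq hflat hx (M.near_res f ha) (hp.res f) (hq.res f)

end Transport

section Grid

theorem grid_apply_zero {α : Type*} {op : α → α → α → α} {p q : ℕ → α} (h : p 0 = q 0) (i : ℕ) :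
    grid op p q i 0 = q i := by
  cases i with
  | zero => exact h
  | succ i => rfl

/-- The concatenation of the path `p` of length `n` with the path `q`. -/
def pathAppend {α : Type*} (n : ℕ) (p q : ℕ → α) (i : ℕ) : α :=
  if i < n then p i else q (i - n)

section PathAppend

variable {α : Type*} {op : α → α → α → α} {n : ℕ} {p p' q : ℕ → α}

theorem pathAppend_add (n : ℕ) (p q : ℕ → α) (i : ℕ) : pathAppend n p q (n + i) = q i := by
  simp [pathAppend]

theorem pathAppend_of_le (h : p n = p' 0) {i : ℕ} (hi : i ≤ n) : pathAppend n p p' i = p i := by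
  rcases hi.lt_or_eq with hi | rfl
  · exact if_pos hi
  · simp [pathAppend, h]

theorem grid_pathAppend_of_le (h : p n = p' 0) (i : ℕ) {j : ℕ} (hj : j ≤ n) :
    grid op (pathAppend n p p') q i j = grid op p q i j := by
  induction i generalizing j with
  | zero => exact pathAppend_of_le h hj
  | succ i ih => exact gridStep_congr fun k hk => ih (hk.trans hj)

theorem grid_pathAppend_add (h : p n = p' 0) (i j : ℕ) :
    grid op (pathAppend n p p') q i (n + j) = grid op p' (fun k => grid op p q k n) i j := by
  induction i generalizing j with
  | zero => exact pathAppend_add n p p' j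
  | succ i ih =>
    rw [grid, gridStep_add, funext ih]
    exact congrArg (gridStep op _ · j) (grid_pathAppend_of_le h (i + 1) le_rfl)

end PathAppend

variable {C : Type u} [Category.{v} C] {J : GrothendieckTopology C} {M : NeighbourSpace.{w} J}
  {L : AffineConnection M} {c d : C} {x y z : M.Pt c} {n n' m m' : ℕ} {p p' q q' : ℕ → M.Pt c}

namespace NeighbourSpace.IsPath

theorem append (hp : M.IsPath n p x y) (hq : M.IsPath m q y z) :
    M.IsPath (n + m) (pathAppend n p q) x z := by
  have h := hp.2.1.trans hq.1.symm
  refine ⟨(pathAppend_of_le h (Nat.zero_le _)).trans hp.1, by rw [pathAppend_add, hq.2.1],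
    fun i hi => ?_⟩
  rcases lt_or_ge i n with hin | hin
  · rw [pathAppend_of_le h hin.le, pathAppend_of_le h hin]
    exact hp.2.2 i hin
  · obtain ⟨i, rfl⟩ := Nat.exists_eq_add_of_le hin
    rw [add_assoc, pathAppend_add, pathAppend_add]
    exact hq.2.2 i (by omega)

theorem grid_row (L : AffineConnection M) (hp : M.IsPath n p x y) (hq : M.IsPath m q x z) {i : ℕ}
    (hi : i ≤ m) : M.IsPath n (grid L.op p q i) (q i) (grid L.op p q i n) := by
  have h0 := grid_apply_zero (op := L.op) (hp.1.trans hq.1.symm)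
  refine ⟨h0 i, rfl, ?_⟩
  induction i with
  | zero => exact hp.2.2
  | succ i ih =>
    exact fun j hj => L.near_gridStep_succ ((h0 i).symm ▸ hq.2.2 i hi) (ih (by omega)) hj

theorem near_grid_succ (L : AffineConnection M) (hp : M.IsPath n p x y) (hq : M.IsPath m q x z)
    {i j : ℕ} (hi : i < m) (hj : j ≤ n) :
    M.near (grid L.op p q i j) (grid L.op p q (i + 1) j) := by
  refine L.near_gridStep ?_ fun k hk => (hp.grid_row L hq hi.le).2.2 k (by omega)
  rw [grid_apply_zero (hp.1.trans hq.1.symm)]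
  exact hq.2.2 i hi

theorem grid_col (L : AffineConnection M) (hp : M.IsPath n p x y) (hq : M.IsPath m q x z) {j : ℕ}
    (hj : j ≤ n) : M.IsPath m (fun i => grid L.op p q i j) (p j) (grid L.op p q m j) :=
  ⟨rfl, rfl, fun _ hi => hp.near_grid_succ L hq hi hj⟩

end NeighbourSpace.IsPath

namespace AffineConnection

theorem res_grid (L : AffineConnection M) (f : d ⟶ c) (hp : M.IsPath n p x y)
    (hq : M.IsPath m q x z) {i j : ℕ} (hi : i ≤ m) (hj : j ≤ n) : M.res f (grid L.op p q i j) =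
      grid L.op (fun i => M.res f (p i)) (fun i => M.res f (q i)) i j := by
  induction i generalizing j with
  | zero => rfl
  | succ i ih =>
    have hrow := hp.grid_row L hq (i := i) (by omega)
    rw [grid, L.res_gridStep f (hrow.1 ▸ hq.2.2 i hi) fun k hk => hrow.2.2 k (by omega)]
    exact gridStep_congr fun k hk => ih (by omega) (by omega)

theorem IsSymmetric.grid_transpose (hsymm : L.IsSymmetric) (hp : M.IsPath n p x y)
    (hq : M.IsPath m q x z) {i j : ℕ} (hi : i ≤ m) (hj : j ≤ n) :
    grid L.op p q i j = grid L.op q p j i := by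
  have h0 := hp.1.trans hq.1.symm
  induction i generalizing j with
  | zero => exact (grid_apply_zero h0.symm j).symm
  | succ i ih =>
    induction j with
    | zero => exact grid_apply_zero h0 _
    | succ j ihj =>
      change L.op (grid L.op p q (i + 1) j) (grid L.op p q i j) (grid L.op p q i (j + 1)) =
        L.op (grid L.op q p (j + 1) i) (grid L.op q p j i) (grid L.op q p j (i + 1))
      rw [hsymm _ _ _ ((hp.grid_row L hq (by omega)).2.2 j (by omega))
        (hp.near_grid_succ L hq (by omega) (by omega)), ih (by omega) (by omega),
        ih (by omega) (by omega), ihj (by omega)]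

variable {R : LineObject.{r} J} (hM : IsManifold R M)
include hM

theorem IsFlat.grid_eq (hflat : L.IsFlat) (hp : M.IsPath n p x y) (hp' : M.IsPath n' p' x y)
    (hq : M.IsPath m q x z) {i : ℕ} (hi : i ≤ m) : grid L.op p q i n = grid L.op p' q i n' := by
  induction i with
  | zero => exact hp.2.1.trans hp'.2.1.symm
  | succ i ih =>
    have hrow := hp.grid_row L hq (i := i) (by omega)
    have hrow' := hp'.grid_row L hq (i := i) (by omega)
    rw [← ih (by omega)] at hrow'
    exact hflat.gridStep_eq hM hrow hrow' (hq.2.2 i hi)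

theorem IsFlat.grid_eq_grid (hflat : L.IsFlat) (hsymm : L.IsSymmetric) (hp : M.IsPath n p x y)
    (hp' : M.IsPath n' p' x y) (hq : M.IsPath m q x z) (hq' : M.IsPath m' q' x z) :
    grid L.op p q m n = grid L.op p' q' m' n' := by
  rw [hflat.grid_eq hM hp hp' hq le_rfl, hsymm.grid_transpose hp' hq le_rfl le_rfl,
    hflat.grid_eq hM hq hq' hp' le_rfl, hsymm.grid_transpose hq' hp' le_rfl le_rfl]

end AffineConnection

end Grid

section Heap

/-- An abelian heap: a ternary operation `op z x y` that behaves like `z - x + y` in an abelian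
group whose zero has been forgotten. -/
structure IsAbelianHeap {α : Type*} (op : α → α → α → α) : Prop where
  op_self (z x : α) : op z x x = z
  op_symm (z x y : α) : op z x y = op y x z
  op_op (z x y t : α) : op (op z x y) y t = op z x t

namespace IsAbelianHeap

variable {α : Type*} {op : α → α → α → α} (h : IsAbelianHeap op)
include h

theorem op_op_right (z x y t : α) : op t y (op z x y) = op t x z := by
  rw [h.op_symm t, h.op_op, h.op_symm]

theorem add_assoc (o x y z : α) : op (op x o y) o z = op x o (op y o z) := by
  rw [← h.op_op x o y (op y o z), h.op_symm y o z, h.op_op_right]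

theorem isAbelianGroup (o : α) : IsAbelianGroup (fun x y => op x o y) o :=
  letI : Zero α := ⟨o⟩
  letI : Add α := ⟨fun x y => op x o y⟩
  letI : Neg α := ⟨fun x => op o x o⟩
  ⟨{ nsmul := nsmulRec
     zsmul := zsmulRec
     add_assoc := h.add_assoc o
     zero_add := fun x => (h.op_symm o o x).trans (h.op_self x o)
     add_zero := fun x => h.op_self x o
     add_comm := fun x y => h.op_symm x o y
     neg_add_cancel := fun x => (h.op_op o x o x).trans (h.op_self o x) },
   fun _ _ => rfl, rfl⟩

theorem bijective (o o' : α) : Function.Bijective fun z => op z o o' :=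
  Function.bijective_iff_has_inverse.2 ⟨fun z => op z o' o,
    fun z => (h.op_op z o o' o).trans (h.op_self z o),
    fun z => (h.op_op z o' o o').trans (h.op_self z o')⟩

theorem map_add (o o' x y : α) :
    op (op x o y) o o' = op (op x o o') o' (op y o o') := by
  rw [h.op_op_right, h.add_assoc, h.add_assoc, h.op_symm y]

end IsAbelianHeap

end Heap

section BigOperation

variable {C : Type u} [Category.{v} C] {J : GrothendieckTopology C} {M : NeighbourSpace.{w} J}
  {L : AffineConnection M}

theorem NeighbourSpace.PathConnected.exists_cover (hpc : M.PathConnected) {c : C}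
    (x y z : M.Pt c) : ∃ S ∈ J c, ∀ {d : C} (f : d ⟶ c), S f →
      (∃ n p, M.IsPath n p (M.res f x) (M.res f y)) ∧
      ∃ n p, M.IsPath n p (M.res f x) (M.res f z) := by
  obtain ⟨S, hS, h⟩ := hpc c x y
  obtain ⟨T, hT, h'⟩ := hpc c x z
  exact ⟨S ⊓ T, J.intersection_covering hS hT, fun f hf => ⟨h f hf.1, h' f hf.2⟩⟩

/-- The internal statement that `t` is the codomain of every grid spanned by a path from `x` to `y`
and a path from `x` to `z`: the paths may live at any stage over that of the points. -/
def AffineConnection.IsGridCodomain (L : AffineConnection M) {c : C} (z x y t : M.Pt c) : Prop :=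
  ∀ ⦃d : C⦄ (f : d ⟶ c) (n m : ℕ) (p q : ℕ → M.Pt d), M.IsPath n p (M.res f x) (M.res f y) →
    M.IsPath m q (M.res f x) (M.res f z) → M.res f t = grid L.op p q m n

namespace AffineConnection

section IsGridCodomain

variable {c d : C} {x y z t : M.Pt c} {n m : ℕ} {p q : ℕ → M.Pt c}

theorem IsGridCodomain.res (h : L.IsGridCodomain z x y t) (f : d ⟶ c) :
    L.IsGridCodomain (M.res f z) (M.res f x) (M.res f y) (M.res f t) :=
  fun _ g n m p q => by
    simp only [← M.res_comp]
    exact h (g ≫ f) n m p q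

theorem IsGridCodomain.eq_grid (h : L.IsGridCodomain z x y t) (hp : M.IsPath n p x y)
    (hq : M.IsPath m q x z) : t = grid L.op p q m n := by
  have := h (𝟙 c) n m p q
  simp only [M.res_id] at this
  exact this hp hq

theorem IsGridCodomain.unique (hpc : M.PathConnected) {t' : M.Pt c}
    (h : L.IsGridCodomain z x y t) (h' : L.IsGridCodomain z x y t') : t = t' := by
  obtain ⟨S, hS, hpq⟩ := hpc.exists_cover x y z
  refine M.eq_of_locally_eq hS fun f hf => ?_
  obtain ⟨⟨n, p, hp⟩, m, q, hq⟩ := hpq f hf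
  rw [h f n m p q hp hq, h' f n m p q hp hq]

theorem IsGridCodomain.of_cover {S : Sieve c} (hS : S ∈ J c)
    (h : ∀ {d : C} (f : d ⟶ c), S f →
      L.IsGridCodomain (M.res f z) (M.res f x) (M.res f y) (M.res f t)) :
    L.IsGridCodomain z x y t := by
  refine fun _ f n m p q hp hq => M.eq_of_locally_eq (J.pullback_stable f hS) fun g hg => ?_
  have hcod := h (g ≫ f) hg
  simp only [M.res_comp] at hcod
  rw [L.res_grid g hp hq le_rfl le_rfl]
  exact hcod.eq_grid (hp.res g) (hq.res g)

variable {R : LineObject.{r} J}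

theorem isGridCodomain_grid (hM : IsManifold R M) (hsymm : L.IsSymmetric) (hflat : L.IsFlat)
    (hp : M.IsPath n p x y) (hq : M.IsPath m q x z) :
    L.IsGridCodomain z x y (grid L.op p q m n) := fun _ f _ _ _ _ hp' hq' =>
  (L.res_grid f hp hq le_rfl le_rfl).trans
    (hflat.grid_eq_grid hM hsymm (hp.res f) hp' (hq.res f) hq')

theorem exists_isGridCodomain (hM : IsManifold R M) (hpc : M.PathConnected)
    (hsymm : L.IsSymmetric) (hflat : L.IsFlat) (z x y : M.Pt c) :
    ∃ t, L.IsGridCodomain z x y t := by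
  obtain ⟨S, hS, hpq⟩ := hpc.exists_cover x y z
  have hlocal : ∀ d (f : d ⟶ c), S f →
      ∃ t, L.IsGridCodomain (M.res f z) (M.res f x) (M.res f y) t := fun d f hf => by
    obtain ⟨⟨n, p, hp⟩, m, q, hq⟩ := hpq f hf
    exact ⟨_, isGridCodomain_grid hM hsymm hflat hp hq⟩
  choose t ht using hlocal
  have hcompat : Presieve.FamilyOfElements.SieveCompatible
      (P := M.sheaf.obj) (S := S) (fun d f hf => t d f hf) := fun d e f g hf => by
    refine IsGridCodomain.unique hpc (ht _ _ _) ?_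
    simp only [M.res_comp]
    exact (ht _ f hf).res g
  obtain ⟨s, hs, -⟩ := (isSheaf_iff_isSheaf_of_type _ _).1 M.sheaf.property S hS _
    ((Presieve.compatible_iff_sieveCompatible _).2 hcompat)
  refine ⟨s, .of_cover hS fun f hf => ?_⟩
  rw [show M.res f s = t _ f hf from hs f hf]
  exact ht _ f hf

end IsGridCodomain

end AffineConnection

namespace TernaryOp

theorem ext_op {B B' : TernaryOp M} (h : ∀ {c : C} (z x y : M.Pt c), B.op z x y = B'.op z x y) :
    B = B' := by
  cases B
  cases B'
  congr
  funext c z x y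
  exact h z x y

theorem exists_isExtensionOf {R : LineObject.{r} J} (hM : IsManifold R M) (hpc : M.PathConnected)
    (hsymm : L.IsSymmetric) (hflat : L.IsFlat) : ∃ B : TernaryOp M, B.IsExtensionOf L := by
  choose op hop using fun {c : C} (z x y : M.Pt c) =>
    L.exists_isGridCodomain hM hpc hsymm hflat z x y
  exact ⟨⟨fun z x y => op z x y, fun f z x y => ((hop z x y).res f).unique hpc (hop _ _ _)⟩,
    fun x y z _ _ _ _ hp hq => (hop z x y).eq_grid hp hq⟩

namespace IsExtensionOf

variable {B : TernaryOp M} (hB : B.IsExtensionOf L)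
include hB

theorem isGridCodomain {c : C} (z x y : M.Pt c) : L.IsGridCodomain z x y (B.op z x y) :=
  fun _ f n m p q hp hq => (B.op_res f z x y).trans (hB _ _ _ n m p q hp hq)

theorem unique (hpc : M.PathConnected) {B' : TernaryOp M} (hB' : B'.IsExtensionOf L) : B' = B :=
  ext_op fun z x y => (hB'.isGridCodomain z x y).unique hpc (hB.isGridCodomain z x y)

theorem op_eq {c : C} {z x y : M.Pt c} (hy : M.near x y) (hz : M.near x z) :
    B.op z x y = L.op z x y := by
  have isPath_one : ∀ t, M.near x t → M.IsPath 1 (fun i => if i = 0 then x else t) x t :=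
    fun t ht => ⟨rfl, rfl, fun i hi => by simpa [Nat.lt_one_iff.1 hi] using ht⟩
  exact hB x y z 1 1 _ _ (isPath_one y hy) (isPath_one z hz)

theorem op_self (hpc : M.PathConnected) {c : C} (z x : M.Pt c) : B.op z x x = z := by
  obtain ⟨S, hS, h⟩ := hpc c x z
  refine M.eq_of_locally_eq hS fun f hf => ?_
  obtain ⟨m, q, hq⟩ := h f hf
  have hconst : M.IsPath 0 (fun _ => M.res f x) (M.res f x) (M.res f x) := ⟨rfl, rfl, by simp⟩
  rw [B.op_res, hB _ _ _ 0 m _ q hconst hq, grid_apply_zero hq.1.symm, hq.2.1]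

theorem op_symm (hpc : M.PathConnected) (hsymm : L.IsSymmetric) {c : C} (z x y : M.Pt c) :
    B.op z x y = B.op y x z := by
  obtain ⟨S, hS, h⟩ := hpc.exists_cover x y z
  refine M.eq_of_locally_eq hS fun f hf => ?_
  obtain ⟨⟨n, p, hp⟩, m, q, hq⟩ := h f hf
  rw [B.op_res, B.op_res, hB _ _ _ n m p q hp hq, hB _ _ _ m n q p hq hp,
    hsymm.grid_transpose hp hq le_rfl le_rfl]

theorem op_op (hpc : M.PathConnected) {c : C} (z x y t : M.Pt c) :
    B.op (B.op z x y) y t = B.op z x t := by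
  obtain ⟨S, hS, h⟩ := hpc.exists_cover x y z
  obtain ⟨T, hT, h'⟩ := hpc c y t
  refine M.eq_of_locally_eq (J.intersection_covering hS hT) fun f hf => ?_
  obtain ⟨⟨n, p, hp⟩, m, q, hq⟩ := h f hf.1
  obtain ⟨n', p', hp'⟩ := h' f hf.2
  have hcol := hp.grid_col L hq le_rfl
  rw [hp.2.1] at hcol
  rw [B.op_res, B.op_res, B.op_res, hB _ _ _ n m p q hp hq, hB _ _ _ n' m p' _ hp' hcol,
    hB _ _ _ _ m _ q (hp.append hp') hq]
  exact (grid_pathAppend_add (hp.2.1.trans hp'.1.symm) m n').symm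

theorem isAbelianHeap (hpc : M.PathConnected) (hsymm : L.IsSymmetric) (c : C) :
    IsAbelianHeap (B.op (c := c)) :=
  ⟨hB.op_self hpc, hB.op_symm hpc hsymm, hB.op_op hpc⟩

end IsExtensionOf

end TernaryOp

end BigOperation

end Synthetic

theorem theorem3p6 {C : Type u} [Category.{v} C] {J : GrothendieckTopology C}
    (R : Synthetic.LineObject.{r} J) (M : Synthetic.NeighbourSpace.{w} J)
    (hM : Synthetic.IsManifold R M) (hpc : M.PathConnected)
    (L : Synthetic.AffineConnection M) (hsymm : L.IsSymmetric) (hflat : L.IsFlat) :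
    ∃ B : Synthetic.TernaryOp M,
      -- `B` is the extended operation `[zxy]`: it is given by grids, it is the only operation
      -- given by grids, and it extends the connection
      B.IsExtensionOf L ∧
      (∀ B' : Synthetic.TernaryOp M, B'.IsExtensionOf L → B' = B) ∧
      (∀ {c : C} (z x y : M.Pt c), M.near x y → M.near x z → B.op z x y = L.op z x y) ∧
      -- for each `o`, the operation `x +_o y = [xoy]` is an abelian group with unit `o`
      (∀ (c : C) (o : M.Pt c), Synthetic.IsAbelianGroup (fun x y => B.op x o y) o) ∧
      -- for all `o`, `o'`, the map `z ↦ [zoo']` is an isomorphism from `+_o` to `+_{o'}`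
      (∀ (c : C) (o o' : M.Pt c),
        Function.Bijective (fun z : M.Pt c => B.op z o o') ∧
        ∀ x y : M.Pt c, B.op (B.op x o y) o o' = B.op (B.op x o o') o' (B.op y o o')) := by
  obtain ⟨B, hB⟩ := Synthetic.TernaryOp.exists_isExtensionOf hM hpc hsymm hflat
  have heap := hB.isAbelianHeap hpc hsymm
  exact ⟨B, hB, fun _ hB' => hB.unique hpc hB', fun _ _ _ hy hz => hB.op_eq hy hz,
    fun c o => (heap c).isAbelianGroup o,
    fun c o o' => ⟨(heap c).bijective o o', (heap c).map_add o o'⟩⟩
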